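/- A cooperative game on the players $N=\{1,\dots,n\}$ is a function $v:2^N\to\mathbb{R}$; assume $v(\emptyset)\le 0$ (usually $v(\emptyset)=0$). For $x\in\mathbb{R}^n$ and $S\subseteq N$ write $x(S)=\sum_{i\in S}x_i$. The core $\mathrm{Core}(v)$ is the set of $x$ with $x(N)=v(N)$ and $x(S)\ge v(S)$ for all $S\subseteq N$. For $\Delta\ge 0$ let $v_\Delta$ be the game with $v_\Delta(N)=v(N)+\Delta$ and $v_\Delta(S)=v(S)$ for $S\subsetneq N$, and let $\mathrm{CoS}(v)=\min\{\Delta\ge 0:\mathrm{Core}(v_\Delta)\neq\emptyset\}$ be the cost of stability. For a probability distribution $\mathcal{D}$ on $2^N$, a payoff vector $x$ is $\varepsilon$-probably stable under $\mathcal{D}$ if $\Pr_{S\sim\mathcal{D}}[x(S)\ge v(S)]\ge 1-\varepsilon$. Given data $(S_1,v(S_1)),\dots,(S_m,v(S_m))$, consider the linear program $$\text{minimize } x(N)\quad\text{subject to } x(S_j)\ge v(S_j),\ j=1,\dots,m,\qquad(\ast)$$ either over all $x\in\mathbb{R}^n$ or over all $x\in\mathbb{R}^n_{\ge 0}$. A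 rule solves $(\ast)$ if, from the data alone, it returns a feasible point whenever there is one and an optimal solution whenever there is one. **Theorem.** Rules that solve $(\ast)$ exist, for either payoff domain. Moreover: 1. The cost-of-stability program, minimize $y(N)$ over $y\in\mathbb{R}^n$ subject to $y(S)\ge v(S)$ for all $S\subseteq N$, has the optimal value $v(N)+\mathrm{CoS}(v)$, and this value is attained. 2. There are sample sizes $m_0(n,\varepsilon,\delta)$, bounded by a polynomial in $n$, $1/\varepsilon$ and $\log(1/\delta)$, such that for every rule that solves $(\ast)$ over either payoff domain, every game $v$ on $n$ players, every distribution $\mathcal{D}$ on $2^N$, all $\varepsilon,\delta\in(0,1)$ and every $m\ge m_0(n,\varepsilon,\delta)$: if $S_1,\dots,S_m$ are drawn i.i.d. from $\mathcal{D}$, then with probability at least $1-\delta$ the output of the rule on $(S_1,v(S_1)),\dots,(S_m,v(S_m))$ is $\varepsilon$-probably stable under $\mathcal{D}$. 3. Let $x^*$ be the output of a rule that solves $(\ast)$ over $\mathbb{R}^n$. For all $S_1,\dots,S_m$ for which $(\ast)$ has an optimal solution, $x^*(N)\le v(N)+\mathrm{CoS}(v)$; in particular $x^*(N)\le v(N)$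 if $\mathrm{Core}(v)\ne\emptyset$. 4. Let $x^*$ be the output of a rule that solves $(\ast)$ over $\mathbb{R}^n_{\ge 0}$, and suppose that $v(\{i\})\ge 0$ for all $i$ (for instance $v\ge 0$). Then for all $S_1,\dots,S_m$ the program $(\ast)$ has an optimal solution, $x^*$ is one, and $x^*(N)\le v(N)+\mathrm{CoS}(v)$; in particular $x^*(N)\le v(N)$ if $\mathrm{Core}(v)\ne\emptyset$. -/

import Mathlib

open MeasureTheory

noncomputable section

namespace CoopGame

/-- The total payoff `x(S) = ∑ i ∈ S, x i` of the coalition `S`. -/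
def payoff {n : ℕ} (x : Fin n → ℝ) (S : Finset (Fin n)) : ℝ := ∑ i ∈ S, x i

/-- A cooperative game on the players `Fin n` is its characteristic function. -/
abbrev Game (n : ℕ) : Type := Finset (Fin n) → ℝ

/-- Imputations: efficient and individually rational payoff vectors. -/
def imputations {n : ℕ} (v : Game n) : Set (Fin n → ℝ) :=
  {x | payoff x Finset.univ = v Finset.univ ∧ ∀ i, v {i} ≤ x i}

/-- The core: imputations from which no coalition wants to deviate. -/
def core {n : ℕ} (v : Game n) : Set (Fin n → ℝ) :=
  {x | x ∈ imputations v ∧ ∀ S : Finset (Fin n), v S ≤ payoff x S}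

/-- The game `v_Δ`: the value of the grand coalition is raised by `Δ`. -/
def subsidized {n : ℕ} (v : Game n) (Δ : ℝ) : Game n :=
  fun S => if S = Finset.univ then v S + Δ else v S

/-- The cost of stability: the least subsidy `Δ ≥ 0` for which `v_Δ` has a non-empty core. -/
def costOfStability {n : ℕ} (v : Game n) : ℝ :=
  sInf {Δ : ℝ | 0 ≤ Δ ∧ (core (subsidized v Δ)).Nonempty}

/-- The objective values of the feasible points of the cost-of-stability linear program
`min x(N)` subject to `x(S) ≥ v(S)` for all coalitions `S`. -/
def stableTotals {n : ℕ} (v : Game n) : Set ℝ :=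
  {t | ∃ y : Fin n → ℝ, (∀ S : Finset (Fin n), v S ≤ payoff y S) ∧ payoff y Finset.univ = t}

/-- A data set of `m` coalitions together with their observed values. -/
abbrev Data (n m : ℕ) : Type := Fin m → Finset (Fin n) × ℝ

/-- The data `(S₁, v(S₁)), …, (Sₘ, v(Sₘ))`. -/
def observe {n m : ℕ} (v : Game n) (S : Fin m → Finset (Fin n)) : Data n m :=
  fun j => (S j, v (S j))

/-- Feasible points of the sampled program: vectors `x` in the payoff domain `K` with
`x(S_j) ≥ v_j` for all `j`. -/
def feasible {n m : ℕ} (K : Set (Fin n → ℝ)) (s : Data n m) : Set (Fin n → ℝ) :=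
  {x | x ∈ K ∧ ∀ j, (s j).2 ≤ payoff x (s j).1}

/-- Optimal solutions of the sampled program `min x(N)` over `feasible K s`. -/
def optimal {n m : ℕ} (K : Set (Fin n → ℝ)) (s : Data n m) : Set (Fin n → ℝ) :=
  {x | x ∈ feasible K s ∧ ∀ y ∈ feasible K s, payoff x Finset.univ ≤ payoff y Finset.univ}

/-- A rule that turns data into a payoff division; it sees nothing of the game or of the
distribution except the data. -/
abbrev Algorithm : Type := ∀ n m : ℕ, Data n m → (Fin n → ℝ)

/-- The rule solves the sampled linear program over the payoff domains `K n`: it returns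
a feasible point if there is one, and an optimal solution if there is one. -/
def SolvesLP (K : ∀ n : ℕ, Set (Fin n → ℝ)) (A : Algorithm) : Prop :=
  ∀ (n m : ℕ) (s : Data n m),
    ((feasible (K n) s).Nonempty → A n m s ∈ feasible (K n) s) ∧
    ((optimal (K n) s).Nonempty → A n m s ∈ optimal (K n) s)

/-- All payoff vectors. -/
def allPayoffs (n : ℕ) : Set (Fin n → ℝ) := Set.univ

/-- The non-negative payoff vectors. -/
def nonnegPayoffs (n : ℕ) : Set (Fin n → ℝ) := {x | ∀ i, 0 ≤ x i}

/-- `x` is `ε`-probably stable under `D`: `Pr_{S ∼ D} [x(S) ≥ v(S)] ≥ 1 - ε`. -/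
def ProbablyStable {n : ℕ} (v : Game n) (D : Measure (Finset (Fin n))) (ε : ℝ)
    (x : Fin n → ℝ) : Prop :=
  ENNReal.ofReal (1 - ε) ≤ D {S | v S ≤ payoff x S}

/-- With probability at least `1 - δ` over `m` independent coalitions with law `D`, the output of
the rule `A` on their observed values is `ε`-probably stable under `D`. -/
def PACStabilizes {n : ℕ} (A : Algorithm) (v : Game n) (D : Measure (Finset (Fin n)))
    (ε δ : ℝ) (m : ℕ) : Prop :=
  ENNReal.ofReal (1 - δ) ≤ Measure.pi (fun _ : Fin m => D)
    {S | ProbablyStable v D ε (A n m (observe v S))}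

end CoopGame

end

open MeasureTheory

noncomputable section

namespace CoopGame

/-! Large constant payoffs satisfy every coalition, so the sampled program is feasible and the
output satisfies all sampled coalitions. Generalization follows from counting the families of
coalitions that one payoff vector can satisfy: a linear relation among indicator vectors bounds
their VC dimension by `n` (`card_le_of_shatters`), and Sauer–Shelah then leaves at most `(n + 1) * 2
^ (n ^ 2)` of them. The logarithm is polynomial in `n`, so a plain union bound over this finite
class suffices. For the cost, every stable vector in the payoff domain is feasible for the sampled
program, so an optimum costs no more than the cheapest stable vector; compactness provides the
latter. -/

lemma continuous_payoff {n : ℕ} (S : Finset (Fin n)) : Continuous fun x => payoff x S := by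
  unfold payoff; fun_prop

lemma payoff_singleton {n : ℕ} (x : Fin n → ℝ) (i : Fin n) : payoff x {i} = x i := by
  simp [payoff]

/-- On a non-empty closed set that is bounded below coordinatewise, the total payoff attains its
minimum. -/
lemma exists_minimal_total {n : ℕ} {F : Set (Fin n → ℝ)} (hF : IsClosed F) (hne : F.Nonempty)
    (b : Fin n → ℝ) (hb : ∀ x ∈ F, ∀ i, b i ≤ x i) :
    ∃ x ∈ F, ∀ y ∈ F, payoff x Finset.univ ≤ payoff y Finset.univ := by
  obtain ⟨x₀, hx₀⟩ := hne
  have hclosed : IsClosed (F ∩ {x | payoff x Finset.univ ≤ payoff x₀ Finset.univ}) :=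
    hF.inter (isClosed_le (continuous_payoff _) continuous_const)
  have hcompact : IsCompact (F ∩ {x | payoff x Finset.univ ≤ payoff x₀ Finset.univ}) := by
    -- All surpluses over `b` are nonnegative and sum to at most `x₀(N) - b(N)`, so each one is
    -- bounded by that.
    refine (isCompact_Icc (a := b)
      (b := fun i => b i + (payoff x₀ Finset.univ - payoff b Finset.univ))).of_isClosed_subset
      hclosed ?_
    rintro x ⟨hxF, hx⟩
    refine ⟨hb x hxF, fun i => ?_⟩
    have h : x i - b i ≤ ∑ j, (x j - b j) :=
      Finset.single_le_sum (f := fun j => x j - b j)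
        (fun j _ => sub_nonneg.2 (hb x hxF j)) (Finset.mem_univ i)
    rw [Finset.sum_sub_distrib] at h
    simp only [Set.mem_ofPred_eq, payoff] at hx ⊢
    linarith
  obtain ⟨x, hx, hmin⟩ := hcompact.exists_isMinOn ⟨x₀, hx₀, le_refl (payoff x₀ Finset.univ)⟩
    (continuous_payoff Finset.univ).continuousOn
  refine ⟨x, hx.1, fun y hy => ?_⟩
  rcases le_total (payoff y Finset.univ) (payoff x₀ Finset.univ) with h | h
  · exact hmin ⟨hy, h⟩
  · exact hx.2.trans h

/-- A sufficiently large constant payoff vector satisfies every coalition. -/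
lemma exists_nonneg_stable {n : ℕ} (v : Game n) (hv : v ∅ ≤ 0) :
    ∃ x : Fin n → ℝ, (∀ i, 0 ≤ x i) ∧ ∀ S, v S ≤ payoff x S := by
  have h0 : 0 ≤ ∑ T, |v T| := Finset.sum_nonneg fun T _ => abs_nonneg _
  -- A single member already pays for a nonempty coalition; only the empty one needs `hv`.
  refine ⟨fun _ => ∑ T, |v T|, fun _ => h0, fun S => ?_⟩
  rcases S.eq_empty_or_nonempty with rfl | ⟨i, hi⟩
  · simpa [payoff] using hv
  · calc v S ≤ |v S| := le_abs_self _
      _ ≤ ∑ T, |v T| := Finset.single_le_sum (f := fun T => |v T|)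
          (fun T _ => abs_nonneg _) (Finset.mem_univ S)
      _ ≤ payoff (fun _ => ∑ T, |v T|) S :=
          Finset.single_le_sum (f := fun _ : Fin n => ∑ T, |v T|) (fun _ _ => h0) hi

lemma isClosed_stable {n : ℕ} (v : Game n) :
    IsClosed {x : Fin n → ℝ | ∀ S, v S ≤ payoff x S} := by
  simp only [Set.ofPred_forall]
  exact isClosed_iInter fun S => isClosed_le continuous_const (continuous_payoff S)

lemma isClosed_feasible {n m : ℕ} {K : Set (Fin n → ℝ)} (hK : IsClosed K) (s : Data n m) :
    IsClosed (feasible K s) := by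
  have h : feasible K s = K ∩ ⋂ j, {x | (s j).2 ≤ payoff x (s j).1} := by
    ext x
    simp [feasible]
  rw [h]
  exact hK.inter <| isClosed_iInter fun j => isClosed_le continuous_const (continuous_payoff _)

lemma isClosed_nonnegPayoffs (n : ℕ) : IsClosed (nonnegPayoffs n) := by
  simp only [nonnegPayoffs, Set.ofPred_forall]
  exact isClosed_iInter fun i => isClosed_le continuous_const (continuous_apply i)

/-- The core of the subsidized game consists of the stable vectors of total `v(N) + Δ`. -/
lemma mem_core_subsidized {n : ℕ} {v : Game n} {Δ : ℝ} (hΔ : 0 ≤ Δ) {x : Fin n → ℝ} :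
    x ∈ core (subsidized v Δ) ↔
      payoff x Finset.univ = v Finset.univ + Δ ∧ ∀ S, v S ≤ payoff x S := by
  constructor
  · rintro ⟨⟨hx, -⟩, h⟩
    refine ⟨by simpa [subsidized] using hx, fun S => le_trans ?_ (h S)⟩
    unfold subsidized
    split_ifs <;> linarith
  · rintro ⟨hx, h⟩
    have h' : ∀ S, subsidized v Δ S ≤ payoff x S := fun S => by
      unfold subsidized
      split_ifs with hS
      · rw [hS, hx]
      · exact h S
    exact ⟨⟨by simpa [subsidized] using hx, fun i => payoff_singleton x i ▸ h' {i}⟩, h'⟩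

/-- The cheapest stable total exceeds `v(N)` by exactly the least subsidy; the gap is nonnegative
because `N` is itself a coalition. -/
lemma isLeast_stableTotals {n : ℕ} (v : Game n) (hv : v ∅ ≤ 0) :
    IsLeast (stableTotals v) (v Finset.univ + costOfStability v) := by
  obtain ⟨x₀, -, hx₀⟩ := exists_nonneg_stable v hv
  obtain ⟨x, hx, hmin⟩ := exists_minimal_total (isClosed_stable v) ⟨x₀, hx₀⟩ (fun i => v {i})
    fun y hy i => payoff_singleton y i ▸ hy {i}
  have hCoS : IsLeast {Δ : ℝ | 0 ≤ Δ ∧ (core (subsidized v Δ)).Nonempty}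
      (payoff x Finset.univ - v Finset.univ) := by
    have hnn : 0 ≤ payoff x Finset.univ - v Finset.univ := sub_nonneg.2 (hx _)
    refine ⟨⟨hnn, x, (mem_core_subsidized hnn).2 ⟨by ring, hx⟩⟩, ?_⟩
    rintro Δ ⟨hΔ, y, hy⟩
    obtain ⟨hyN, hy⟩ := (mem_core_subsidized hΔ).1 hy
    have := hmin y hy
    linarith
  have heq : v Finset.univ + costOfStability v = payoff x Finset.univ := by
    rw [costOfStability, hCoS.csInf_eq]; ring
  rw [heq]
  exact ⟨⟨x, hx, rfl⟩, by rintro _ ⟨y, hy, rfl⟩; exact hmin y hy⟩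

lemma exists_solvesLP (K : ∀ n : ℕ, Set (Fin n → ℝ)) : ∃ A, SolvesLP K A := by
  have h : ∀ (n m : ℕ) (s : Data n m), ∃ x : Fin n → ℝ,
      ((feasible (K n) s).Nonempty → x ∈ feasible (K n) s) ∧
      ((optimal (K n) s).Nonempty → x ∈ optimal (K n) s) := by
    intro n m s
    by_cases ho : (optimal (K n) s).Nonempty
    · obtain ⟨x, hx⟩ := ho
      exact ⟨x, fun _ => hx.1, fun _ => hx⟩
    · by_cases hf : (feasible (K n) s).Nonempty
      · obtain ⟨x, hx⟩ := hf
        exact ⟨x, fun _ => hx, fun h => absurd h ho⟩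
      · exact ⟨0, fun h => absurd h hf, fun h => absurd h ho⟩
  choose A hA using h
  exact ⟨A, hA⟩

/-! ### VC dimension of the satisfied families -/

/-- The family of all sets of coalitions that can be satisfied exactly by a payoff vector. -/
def satisfiedFamilies {n : ℕ} (v : Game n) : Finset (Finset (Finset (Fin n))) := by
  classical
  exact Finset.univ.filter fun h => ∃ x : Fin n → ℝ, ∀ S, S ∈ h ↔ v S ≤ payoff x S

lemma mem_satisfiedFamilies {n : ℕ} {v : Game n} {h : Finset (Finset (Fin n))} :
    h ∈ satisfiedFamilies v ↔ ∃ x : Fin n → ℝ, ∀ S, S ∈ h ↔ v S ≤ payoff x S := by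
  simp [satisfiedFamilies]

/-- More than `n` coalitions satisfy a non-trivial linear relation. -/
lemma exists_payoff_relation {n : ℕ} (T : Finset (Finset (Fin n))) (hT : n < T.card) :
    ∃ c : Finset (Fin n) → ℝ, (∀ x, ∑ S ∈ T, c S * payoff x S = 0) ∧ ∃ S ∈ T, 0 < c S := by
  let f : T → Fin n → ℝ := fun S i => if i ∈ S.1 then 1 else 0
  have hdep : ¬ LinearIndependent ℝ f := fun hf => by
    have := hf.fintype_card_le_finrank
    simp at this
    omega
  obtain ⟨g, hg, S₀, hS₀⟩ := Fintype.not_linearIndependent_iff.1 hdep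
  have hrel : ∀ x, ∑ S : T, g S * payoff x S.1 = 0 := by
    intro x
    have hcoord : ∀ i, ∑ S : T, g S * f S i = 0 := fun i => by
      simpa [Finset.sum_apply] using congrFun hg i
    calc ∑ S : T, g S * payoff x S.1 = ∑ S : T, ∑ i, x i * (g S * f S i) := by
          refine Finset.sum_congr rfl fun S _ => ?_
          simp only [payoff, f, Finset.mul_sum, mul_ite, mul_one, mul_zero]
          rw [Finset.sum_ite_mem, Finset.univ_inter]
          exact Finset.sum_congr rfl fun i _ => mul_comm _ _
      _ = 0 := by
          rw [Finset.sum_comm]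
          exact Finset.sum_eq_zero fun i _ => by rw [← Finset.mul_sum, hcoord, mul_zero]
  -- The sign `σ` serves to make the nonzero coefficient at `S₀` positive.
  have hext : ∀ σ : ℝ, ∀ x,
      ∑ S ∈ T, (if h : S ∈ T then σ * g ⟨S, h⟩ else 0) * payoff x S = 0 := by
    intro σ x
    rw [← Finset.sum_coe_sort]
    simp only [Finset.coe_mem, dite_true, Subtype.coe_eta, mul_assoc]
    rw [← Finset.mul_sum, hrel, mul_zero]
  rcases lt_or_gt_of_ne hS₀ with h | h
  · exact ⟨_, hext (-1), S₀.1, S₀.2, by simpa using h⟩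
  · exact ⟨_, hext 1, S₀.1, S₀.2, by simpa using h⟩

/-- The satisfied families of a game on `n` players have VC dimension at most `n`. -/
lemma card_le_of_shatters {n : ℕ} (v : Game n) {T : Finset (Finset (Fin n))}
    (hT : (satisfiedFamilies v).Shatters T) : T.card ≤ n := by
  by_contra! hcard
  obtain ⟨c, hc, S₀, hS₀, hpos⟩ := exists_payoff_relation T hcard
  have hreal : ∀ P : Finset (Fin n) → Prop,
      ∃ x : Fin n → ℝ, ∀ S ∈ T, (P S ↔ v S ≤ payoff x S) := by
    classical
    intro P
    obtain ⟨u, hu, huT⟩ := hT (Finset.filter_subset P T)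
    obtain ⟨x, hx⟩ := mem_satisfiedFamilies.1 hu
    refine ⟨x, fun S hS => ?_⟩
    rw [← hx S]
    have := Finset.ext_iff.1 huT S
    simpa [hS] using this.symm
  -- The weighted excess does not depend on `x`, yet two opposite patterns force it to be negative
  -- and nonnegative. Strictness comes from `S₀`, which `x` violates: a satisfied constraint could
  -- be tight.
  have hsum : ∀ x, ∑ S ∈ T, c S * (payoff x S - v S) = - ∑ S ∈ T, c S * v S := fun x => by
    simp [mul_sub, Finset.sum_sub_distrib, hc]
  obtain ⟨x, hx⟩ := hreal fun S => c S < 0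
  obtain ⟨y, hy⟩ := hreal fun S => 0 < c S
  have hneg : ∑ S ∈ T, c S * (payoff x S - v S) < 0 := by
    refine Finset.sum_neg' (fun S hS => ?_) ⟨S₀, hS₀, ?_⟩
    · by_cases h : c S < 0
      · exact mul_nonpos_of_nonpos_of_nonneg h.le (sub_nonneg.2 ((hx S hS).1 h))
      · have := mt (hx S hS).2 h
        exact mul_nonpos_of_nonneg_of_nonpos (not_lt.1 h) (by linarith)
    · have := mt (hx S₀ hS₀).2 hpos.not_gt
      exact mul_neg_of_pos_of_neg hpos (by linarith)
  have hnonneg : 0 ≤ ∑ S ∈ T, c S * (payoff y S - v S) := by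
    refine Finset.sum_nonneg fun S hS => ?_
    by_cases h : 0 < c S
    · exact mul_nonneg h.le (sub_nonneg.2 ((hy S hS).1 h))
    · have := mt (hy S hS).2 h
      exact mul_nonneg_of_nonpos_of_nonpos (not_lt.1 h) (by linarith)
  rw [hsum] at hneg hnonneg
  linarith

lemma card_satisfiedFamilies_le {n : ℕ} (v : Game n) :
    (satisfiedFamilies v).card ≤ (n + 1) * (2 ^ n) ^ n := by
  have hvc : (satisfiedFamilies v).vcDim ≤ n :=
    Finset.sup_le fun T hT => card_le_of_shatters v (Finset.mem_shatterer.1 hT)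
  calc (satisfiedFamilies v).card
      ≤ (satisfiedFamilies v).shatterer.card := Finset.card_le_card_shatterer _
    _ ≤ ∑ k ∈ Finset.Iic (satisfiedFamilies v).vcDim,
          (Fintype.card (Finset (Fin n))).choose k := Finset.card_shatterer_le_sum_vcDim
    _ ≤ ∑ k ∈ Finset.Iic n, (Fintype.card (Finset (Fin n))).choose k :=
        Finset.sum_le_sum_of_subset (Finset.Iic_subset_Iic.2 hvc)
    _ ≤ ∑ k ∈ Finset.Iic n, (2 ^ n) ^ n := by
        refine Finset.sum_le_sum fun k hk => (Nat.choose_le_pow _ _).trans ?_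
        rw [Fintype.card_finset, Fintype.card_fin]
        exact Nat.pow_le_pow_right (by positivity) (Finset.mem_Iic.1 hk)
    _ = (n + 1) * (2 ^ n) ^ n := by simp

/-! ### Sample complexity -/

/-- The union bound for a finite hypothesis class: the probability that some hypothesis of measure
less than `1 - ε` contains all `m` sample points. -/
lemma measure_exists_consistent_bad_le {α : Type*} [MeasurableSpace α]
    (D : Measure α) [IsProbabilityMeasure D] (H : Finset (Finset α)) {ε : ℝ} (hε : ε < 1) (m : ℕ) :
    Measure.pi (fun _ : Fin m => D)
      {S | ∃ h ∈ H, D (h : Set α) < ENNReal.ofReal (1 - ε) ∧ ∀ j, S j ∈ h}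
      ≤ ENNReal.ofReal (H.card * Real.exp (-ε * m)) := by
  classical
  have hsub : {S : Fin m → α | ∃ h ∈ H, D (h : Set α) < ENNReal.ofReal (1 - ε) ∧ ∀ j, S j ∈ h} ⊆
      ⋃ h ∈ H.filter (fun h : Finset α => D (h : Set α) < ENNReal.ofReal (1 - ε)),
        Set.univ.pi fun _ => (h : Set α) := by
    rintro S ⟨h, hH, hbad, hS⟩
    simp only [Set.mem_iUnion]
    exact ⟨h, Finset.mem_filter.2 ⟨hH, hbad⟩, fun j _ => hS j⟩
  have hexp : ENNReal.ofReal (1 - ε) ^ m ≤ ENNReal.ofReal (Real.exp (-ε * m)) := by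
    rw [← ENNReal.ofReal_pow (by linarith)]
    refine ENNReal.ofReal_le_ofReal ?_
    rw [mul_comm, Real.exp_nat_mul]
    exact pow_le_pow_left₀ (by linarith) (Real.one_sub_le_exp_neg ε) m
  calc _ ≤ _ := measure_mono hsub
    _ ≤ ∑ h ∈ H.filter (fun h : Finset α => D (h : Set α) < ENNReal.ofReal (1 - ε)),
          Measure.pi (fun _ : Fin m => D) (Set.univ.pi fun _ => (h : Set α)) :=
        measure_biUnion_finset_le _ _
    _ ≤ ∑ h ∈ H.filter (fun h : Finset α => D (h : Set α) < ENNReal.ofReal (1 - ε)),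
          ENNReal.ofReal (Real.exp (-ε * m)) := by
        refine Finset.sum_le_sum fun h hh => ?_
        rw [Measure.pi_pi, Finset.prod_const, Finset.card_univ, Fintype.card_fin]
        exact (pow_le_pow_left' (Finset.mem_filter.1 hh).2.le m).trans hexp
    _ ≤ ∑ h ∈ H, ENNReal.ofReal (Real.exp (-ε * m)) :=
        Finset.sum_le_sum_of_subset (Finset.filter_subset _ _)
    _ = ENNReal.ofReal (H.card * Real.exp (-ε * m)) := by
        rw [Finset.sum_const, nsmul_eq_mul, ENNReal.ofReal_mul (Nat.cast_nonneg _),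
          ENNReal.ofReal_natCast]

/-- A number of samples that suffices for PAC stabilization. -/
def sampleSize (n : ℕ) (ε δ : ℝ) : ℕ :=
  ⌈((n : ℝ) + n ^ 2 + Real.log (1 / δ)) * (1 / ε)⌉₊

lemma card_mul_exp_le {n m : ℕ} (v : Game n) {ε δ : ℝ} (hε : 0 < ε) (hδ : 0 < δ)
    (hm : sampleSize n ε δ ≤ m) :
    (satisfiedFamilies v).card * Real.exp (-ε * m) ≤ δ := by
  have hm' : (n : ℝ) + n ^ 2 + Real.log (1 / δ) ≤ ε * m := by
    have := Nat.ceil_le.1 hm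
    rw [mul_one_div, div_le_iff₀ hε] at this
    linarith
  have hcard : ((satisfiedFamilies v).card : ℝ) ≤ Real.exp (n + n ^ 2) := by
    -- Replacing 2 by `e` puts the count in the form `exp (n + n ^ 2)`, which explains `sampleSize`.
    have h2 : (2 : ℝ) ≤ Real.exp 1 := by
      have := Real.add_one_le_exp 1
      linarith
    calc ((satisfiedFamilies v).card : ℝ) ≤ (n + 1) * (2 ^ n) ^ n := by
          exact_mod_cast card_satisfiedFamilies_le v
      _ ≤ Real.exp n * (Real.exp 1 ^ n) ^ n := by
          gcongr
          exact Real.add_one_le_exp _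
      _ = Real.exp (n + n ^ 2) := by
          rw [← pow_mul, ← Real.exp_nat_mul, ← Real.exp_add]
          push_cast
          ring_nf
  calc (satisfiedFamilies v).card * Real.exp (-ε * m)
      ≤ Real.exp (n + n ^ 2) * Real.exp (-ε * m) := by gcongr
    _ = Real.exp (n + n ^ 2 - ε * m) := by rw [← Real.exp_add]; ring_nf
    _ ≤ Real.exp (Real.log δ) := by
        refine Real.exp_le_exp.2 ?_
        rw [one_div, Real.log_inv] at hm'
        linarith
    _ = δ := Real.exp_log hδ

/-- A rule that satisfies all observed coalitions stabilizes with `sampleSize n ε δ` samples. -/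
lemma pacStabilizes_of_consistent {A : Algorithm} {n m : ℕ} {v : Game n}
    (hA : ∀ (S : Fin m → Finset (Fin n)) (j : Fin m), v (S j) ≤ payoff (A n m (observe v S)) (S j))
    (D : Measure (Finset (Fin n))) [IsProbabilityMeasure D] {ε δ : ℝ} (hε : 0 < ε) (hε' : ε < 1)
    (hδ : 0 < δ) (hm : sampleSize n ε δ ≤ m) : PACStabilizes A v D ε δ m := by
  classical
  have hbad : Measure.pi (fun _ : Fin m => D)
      {S | ProbablyStable v D ε (A n m (observe v S))}ᶜ ≤ ENNReal.ofReal δ := by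
    refine (measure_mono ?_).trans ((measure_exists_consistent_bad_le D (satisfiedFamilies v)
      hε' m).trans (ENNReal.ofReal_le_ofReal (card_mul_exp_le v hε hδ hm)))
    -- The family satisfied by an unstable output is a bad hypothesis containing every sample.
    intro S hS
    refine ⟨Finset.univ.filter fun T => v T ≤ payoff (A n m (observe v S)) T,
      mem_satisfiedFamilies.2 ⟨A n m (observe v S), by simp⟩, ?_, by simpa using hA S⟩
    simpa [ProbablyStable] using hS
  have h := prob_compl_eq_one_sub (μ := Measure.pi (fun _ : Fin m => D))
    (MeasurableSet.of_discrete (s := {S | ProbablyStable v D ε (A n m (observe v S))}ᶜ))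
  rw [compl_compl] at h
  rw [PACStabilizes, h, ENNReal.ofReal_sub _ hδ.le, ENNReal.ofReal_one]
  exact tsub_le_tsub_left hbad 1

/-- The constant 1 in the polynomial absorbs the rounding up. -/
lemma sampleSize_le_eval {n : ℕ} {ε δ : ℝ} (hε : 0 < ε) (hδ : 0 < δ) (hδ' : δ < 1) :
    (sampleSize n ε δ : ℝ) ≤ MvPolynomial.eval ![(n : ℝ), 1 / ε, Real.log (1 / δ)]
      ((MvPolynomial.X 0 + MvPolynomial.X 0 ^ 2 + MvPolynomial.X 2) * MvPolynomial.X 1 + 1) := by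
  have hlog : 0 ≤ Real.log (1 / δ) := Real.log_nonneg (by rw [le_div_iff₀ hδ]; linarith)
  have := (Nat.ceil_lt_add_one
    (show 0 ≤ ((n : ℝ) + n ^ 2 + Real.log (1 / δ)) * (1 / ε) by positivity)).le
  simpa [sampleSize] using this

/-! ### Total payoff of optimal solutions -/

lemma feasible_observe_of_stable {n m : ℕ} {v : Game n} {K : Set (Fin n → ℝ)} {x : Fin n → ℝ}
    (hxK : x ∈ K) (hx : ∀ S, v S ≤ payoff x S) (S : Fin m → Finset (Fin n)) :
    x ∈ feasible K (observe v S) :=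
  ⟨hxK, fun j => hx (S j)⟩

/-- If every stable vector lies in the payoff domain, then an optimal solution of the sampled
program costs at most `v(N) + CoS(v)`, and at most `v(N)` if the core is non-empty. -/
lemma total_le_of_optimal {n m : ℕ} {v : Game n} (hv : v ∅ ≤ 0) {K : Set (Fin n → ℝ)}
    (hK : ∀ y : Fin n → ℝ, (∀ S, v S ≤ payoff y S) → y ∈ K) {S : Fin m → Finset (Fin n)}
    {x : Fin n → ℝ} (hx : x ∈ optimal K (observe v S)) :
    payoff x Finset.univ ≤ v Finset.univ + costOfStability v ∧
      ((core v).Nonempty → payoff x Finset.univ ≤ v Finset.univ) := by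
  constructor
  · obtain ⟨y, hy, hyN⟩ := (isLeast_stableTotals v hv).1
    rw [← hyN]
    exact hx.2 y (feasible_observe_of_stable (hK y hy) hy S)
  · rintro ⟨y, ⟨hyN, -⟩, hy⟩
    rw [← hyN]
    exact hx.2 y (feasible_observe_of_stable (hK y hy) hy S)

lemma optimal_nonnegPayoffs_nonempty {n m : ℕ} (v : Game n) (hv : v ∅ ≤ 0)
    (S : Fin m → Finset (Fin n)) : (optimal (nonnegPayoffs n) (observe v S)).Nonempty := by
  obtain ⟨x₀, hx₀, hst⟩ := exists_nonneg_stable v hv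
  exact exists_minimal_total (isClosed_feasible (isClosed_nonnegPayoffs n) (observe v S))
    ⟨x₀, feasible_observe_of_stable (K := nonnegPayoffs n) hx₀ hst S⟩ 0 fun y hy => hy.1

end CoopGame

end

theorem theorem1 :
    -- the linear programs over both payoff domains can be solved by a rule that sees only the data
    (∃ A, CoopGame.SolvesLP CoopGame.allPayoffs A) ∧
    (∃ A, CoopGame.SolvesLP CoopGame.nonnegPayoffs A) ∧
    -- the least total payoff that stabilizes a game is `v(N) + CoS(v)`
    (∀ (n : ℕ) (v : CoopGame.Game n), v ∅ ≤ 0 →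
      IsLeast (CoopGame.stableTotals v) (v Finset.univ + CoopGame.costOfStability v)) ∧
    -- PAC stabilization, with a polynomial number of samples
    (∃ (m₀ : ℕ → ℝ → ℝ → ℕ) (p : MvPolynomial (Fin 3) ℝ),
      (∀ (n : ℕ) (ε δ : ℝ), 0 < ε → ε < 1 → 0 < δ → δ < 1 →
        (m₀ n ε δ : ℝ) ≤ MvPolynomial.eval ![(n : ℝ), 1 / ε, Real.log (1 / δ)] p) ∧
      ∀ A : CoopGame.Algorithm,
        CoopGame.SolvesLP CoopGame.allPayoffs A ∨ CoopGame.SolvesLP CoopGame.nonnegPayoffs A →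
        ∀ (n : ℕ) (v : CoopGame.Game n), v ∅ ≤ 0 →
        ∀ (D : MeasureTheory.Measure (Finset (Fin n))), MeasureTheory.IsProbabilityMeasure D →
        ∀ (ε δ : ℝ), 0 < ε → ε < 1 → 0 < δ → δ < 1 →
        ∀ m : ℕ, m₀ n ε δ ≤ m → CoopGame.PACStabilizes A v D ε δ m) ∧
    -- total payoff, program over all payoff vectors, whenever that program has an optimal solution
    (∀ A : CoopGame.Algorithm, CoopGame.SolvesLP CoopGame.allPayoffs A →
      ∀ (n : ℕ) (v : CoopGame.Game n), v ∅ ≤ 0 →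
      ∀ (m : ℕ) (S : Fin m → Finset (Fin n)),
        (CoopGame.optimal (CoopGame.allPayoffs n) (CoopGame.observe v S)).Nonempty →
        CoopGame.payoff (A n m (CoopGame.observe v S)) Finset.univ
            ≤ v Finset.univ + CoopGame.costOfStability v ∧
        ((CoopGame.core v).Nonempty →
          CoopGame.payoff (A n m (CoopGame.observe v S)) Finset.univ ≤ v Finset.univ)) ∧
    -- total payoff, program over the non-negative payoff vectors: it always has an optimal solution
    (∀ A : CoopGame.Algorithm, CoopGame.SolvesLP CoopGame.nonnegPayoffs A →
      ∀ (n : ℕ) (v : CoopGame.Game n), v ∅ ≤ 0 → (∀ i, 0 ≤ v {i}) →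
      ∀ (m : ℕ) (S : Fin m → Finset (Fin n)),
        A n m (CoopGame.observe v S) ∈
            CoopGame.optimal (CoopGame.nonnegPayoffs n) (CoopGame.observe v S) ∧
        CoopGame.payoff (A n m (CoopGame.observe v S)) Finset.univ
            ≤ v Finset.univ + CoopGame.costOfStability v ∧
        ((CoopGame.core v).Nonempty →
          CoopGame.payoff (A n m (CoopGame.observe v S)) Finset.univ ≤ v Finset.univ)) := by
  refine ⟨CoopGame.exists_solvesLP _, CoopGame.exists_solvesLP _,
    fun n v hv => CoopGame.isLeast_stableTotals v hv,
    ⟨CoopGame.sampleSize, _, fun n ε δ hε _ hδ hδ' => CoopGame.sampleSize_le_eval hε hδ hδ', ?_⟩,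
    ?_, ?_⟩
  · intro A hA n v hv D hD ε δ hε hε' hδ _ m hm
    refine CoopGame.pacStabilizes_of_consistent (fun S j => ?_) D hε hε' hδ hm
    obtain ⟨x, hx, hst⟩ := CoopGame.exists_nonneg_stable v hv
    rcases hA with hA | hA
    · exact ((hA n m _).1 ⟨x, CoopGame.feasible_observe_of_stable (Set.mem_univ x) hst S⟩).2 j
    · exact ((hA n m _).1 ⟨x, CoopGame.feasible_observe_of_stable
        (K := CoopGame.nonnegPayoffs n) hx hst S⟩).2 j
  · intro A hA n v hv m S hopt
    exact CoopGame.total_le_of_optimal hv (fun y _ => Set.mem_univ y) ((hA n m _).2 hopt)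
  · intro A hA n v hv hv1 m S
    have hopt := (hA n m _).2 (CoopGame.optimal_nonnegPayoffs_nonempty v hv S)
    -- Singleton constraints put every stable vector in the nonnegative domain.
    exact ⟨hopt, CoopGame.total_le_of_optimal (K := CoopGame.nonnegPayoffs n) hv
      (fun y hy i => (hv1 i).trans (CoopGame.payoff_singleton y i ▸ hy {i})) hopt⟩
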